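/- Work in the field $\mathbb{Q}((q))$ of formal Laurent series. Let $$\varphi(q)=\sum_{k=-\infty}^{\infty}q^{k^2},\qquad \psi(q)=\sum_{k\ge 0}q^{k(k+1)/2},\qquad G(q)=\frac{\psi(q^3)}{\psi(q)},$$ $$\xi=\frac{\varphi(-q^9)}{\varphi(-q)},\qquad \zeta=q\,\frac{\psi(q^9)}{\psi(q)},\qquad \delta=q^{-2}\,\frac{G(q)}{G(q^9)},$$ and let $U\bigl(\sum_n a_nq^n\bigr)=\sum_n a_{3n}q^n$. Then for every integer $i\ge 0$ there is exactly one polynomial $\sum_j X_i(j)\,T^j\in\mathbb{Z}[T]$ such that $$U(\xi^i)=\sum_j X_i(j)\,\xi^j,$$ and with these same integer coefficients $$U(\zeta^i)=\sum_j X_i(j)\,\zeta^j .$$ Moreover, for every $i\ge 0$, $$U(\delta\zeta^i)=\zeta^{-1}\,U(\zeta^{i+1}).$$ -/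

import Mathlib

open scoped PowerSeries LaurentSeries Polynomial

namespace ThetaSeries

noncomputable section

/-- `φ(q) = ∑_{k ∈ ℤ} q ^ (k ^ 2)` as a formal power series: the coefficient of `q ^ n` is the
number of integers `k` with `k ^ 2 = n`. -/
def phi : ℚ⟦X⟧ :=
  PowerSeries.mk fun n => (Set.ncard {k : ℤ | k ^ 2 = (n : ℤ)} : ℚ)

/-- `ψ(q) = ∑_{k ≥ 0} q ^ (k (k + 1) / 2)` as a formal power series: the coefficient of `q ^ n` is
the number of natural numbers `k` with `k (k + 1) / 2 = n` (the division is exact). -/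
def psi : ℚ⟦X⟧ :=
  PowerSeries.mk fun n => (Set.ncard {k : ℕ | k * (k + 1) / 2 = n} : ℚ)

/-- `φ(-q)`. -/
def phiNeg : ℚ⟦X⟧ := PowerSeries.evalNegHom phi

/-- The substitution `q ↦ q ^ m` in a formal power series, for `m ≠ 0`. -/
def dilate (m : ℕ) [NeZero m] (f : ℚ⟦X⟧) : ℚ⟦X⟧ :=
  PowerSeries.expand m (NeZero.ne m) f

/-- A formal power series regarded as a formal Laurent series. -/
def toLaurent (f : ℚ⟦X⟧) : ℚ⸨X⸩ := HahnSeries.ofPowerSeries ℤ ℚ f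

/-- The variable `q` as a formal Laurent series. -/
def q : ℚ⸨X⸩ := HahnSeries.single (1 : ℤ) (1 : ℚ)

/-- `G(q) = ψ(q ^ 3) / ψ(q)`. -/
def G : ℚ⟦X⟧ := dilate 3 psi * psi⁻¹

/-- `ξ(q) = φ(-q ^ 9) / φ(-q)`. -/
def xi : ℚ⸨X⸩ := toLaurent (dilate 9 phiNeg) / toLaurent phiNeg

/-- `ζ(q) = q ψ(q ^ 9) / ψ(q)`. -/
def zeta : ℚ⸨X⸩ := q * (toLaurent (dilate 9 psi) / toLaurent psi)

/-- `δ(q) = q ^ (-2) G(q) / G(q ^ 9)`. -/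
def delta : ℚ⸨X⸩ := q ^ (-2 : ℤ) * (toLaurent G / toLaurent (dilate 9 G))

theorem bddBelow_support_three_mul (f : ℚ⸨X⸩) :
    BddBelow (Function.support fun n : ℤ => f.coeff (3 * n)) := by
  refine ⟨-|f.order|, fun n hn => ?_⟩
  have h : f.order ≤ 3 * n := HahnSeries.order_le_of_coeff_ne_zero hn
  have h1 := neg_abs_le f.order
  have h2 := abs_nonneg f.order
  omega

/-- The unitizing operator of degree three, `U (∑ aₙ qⁿ) = ∑ a₃ₙ qⁿ`. -/
def U (f : ℚ⸨X⸩) : ℚ⸨X⸩ :=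
  HahnSeries.ofSuppBddBelow (fun n : ℤ => f.coeff (3 * n)) (bddBelow_support_three_mul f)

end

end ThetaSeries

/-! Both halves are one argument. Let f be φ(-q) or ψ(q), and let g be φ(-q⁹) or qψ(q⁹), so that y =
g/f is ξ or ζ. Squares and triangular numbers are 0 or 1 modulo 3; g is the part of f with exponents
0 (for φ) or 1 (for ψ), and h = f - g is the other part. Multiplying the three conjugates f(ω^j q)
therefore gives g³ + h³ up to a power of q. Gauss's product expansions evaluate the same norm as
F(q³)⁴/F(q⁹), where F is φ(-q) or ψ(q) (`cubic_relation`).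

Put m = y - 3y² + 3y³ and u = 1/y - 1 = h/g. The norm relation becomes m(q³)(1 + u³) = 1, with the
exponents of u in one nonzero class modulo 3. Hence y = m(q³)(1 - u + u²) and y³ = m(q³)(1 - 3y +
3y²). Since U is linear over series in q³, the first equation gives U(y) and U(y²), and the second
gives a three-term recurrence for U(yⁱ). It is the same recurrence for ξ and ζ, hence the same
polynomials (`U_pow_eq_aeval`).

Uniqueness holds because ξ, a nonconstant power series, is transcendental. The last claim follows
from δ = ζ(q)/ζ(q³). -/

namespace ThetaSeries

open Finset

noncomputable section

/-! ### Finite forms of Gauss's identities -/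

/-- Here `v k` plays the role of 1/(1 + x^k), so 2 `v 0` = 1. The term s = 0 is the partial product
of (1 - x^k)/(1 + x^k), and all other terms are divisible by x^(n+1), so product and theta series
agree to that order. -/
theorem gauss_phi_finite {R : Type*} [CommRing R] (x : R) (v : ℕ → R)
    (hv : ∀ k, (1 + x ^ k) * v k = 1) (n : ℕ) :
    ∑ s ∈ range (n + 1), 2 * (-1) ^ s * v s *
        (∏ k ∈ Ico s n, (1 - x ^ (k + 1)) * v (k + 1)) * x ^ (s * (n + 1)) =
      2 * ∑ s ∈ range (n + 1), (-1) ^ s * x ^ (s ^ 2) - 1 := by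
  have h0 : 2 * v 0 = 1 := by have := hv 0; rw [pow_zero] at this; linear_combination this
  induction n with
  | zero => simp; linear_combination h0
  | succ n ih =>
    -- The differences between corresponding terms of the sums for n + 1 and n telescope once
    -- multiplied by 1 + x^(n+1). Taking t = n leaves only the new term s = n + 1 to add.
    have tel : ∀ t ≤ n, (1 + x ^ (n + 1)) * ∑ s ∈ range (t + 1), (2 * (-1) ^ s * v s *
        ((∏ k ∈ Ico s n, (1 - x ^ (k + 1)) * v (k + 1)) * ((1 - x ^ (n + 1)) * v (n + 1))) *
          x ^ (s * (n + 2)) - 2 * (-1) ^ s * v s *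
        (∏ k ∈ Ico s n, (1 - x ^ (k + 1)) * v (k + 1)) * x ^ (s * (n + 1))) =
        -(2 * (-1) ^ t * (∏ k ∈ Ico t n, (1 - x ^ (k + 1)) * v (k + 1)) *
          x ^ ((t + 1) * (n + 1))) := by
      intro t
      induction t with
      | zero =>
        intro _
        simp only [zero_add, sum_range_one]
        generalize (∏ k ∈ Ico 0 n, (1 - x ^ (k + 1)) * v (k + 1)) = P
        linear_combination (2 * v 0 * P * (1 - x ^ (n + 1))) * hv (n + 1) -
          2 * P * x ^ (n + 1) * h0
      | succ t iht =>
        intro ht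
        rw [sum_range_succ, mul_add, iht (by omega), prod_eq_prod_Ico_succ_bot (by omega : t < n)]
        generalize (∏ k ∈ Ico (t + 1) n, (1 - x ^ (k + 1)) * v (k + 1)) = P
        linear_combination (2 * (-1) ^ (t + 1) * v (t + 1) * P * (1 - x ^ (n + 1)) *
          x ^ ((t + 1) * (n + 2))) * hv (n + 1) -
          2 * (-1) ^ (t + 1) * P * x ^ ((t + 2) * (n + 1)) * hv (t + 1)
    have key := tel n le_rfl
    rw [sum_sub_distrib, ih, Ico_self, prod_empty] at key
    rw [sum_range_succ, sum_range_succ _ (n + 1), Ico_self, prod_empty]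
    have e : ∀ s ∈ range (n + 1), 2 * (-1) ^ s * v s *
        (∏ k ∈ Ico s (n + 1), (1 - x ^ (k + 1)) * v (k + 1)) * x ^ (s * (n + 1 + 1)) =
        2 * (-1) ^ s * v s *
        ((∏ k ∈ Ico s n, (1 - x ^ (k + 1)) * v (k + 1)) * ((1 - x ^ (n + 1)) * v (n + 1))) *
          x ^ (s * (n + 2)) := by
      intro s hs
      rw [prod_Ico_succ_top (by have := mem_range.1 hs; omega)]
    rw [sum_congr rfl e]
    generalize (∑ s ∈ range (n + 1), 2 * (-1) ^ s * v s *
        ((∏ k ∈ Ico s n, (1 - x ^ (k + 1)) * v (k + 1)) * ((1 - x ^ (n + 1)) * v (n + 1))) *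
          x ^ (s * (n + 2))) = A at *
    generalize ∑ s ∈ range (n + 1), (-1 : R) ^ s * x ^ (s ^ 2) = B at *
    linear_combination v (n + 1) * key - (A - (2 * B - 1) - 2 * (-1) ^ (n + 1) * x ^ ((n + 1) ^ 2)) * hv (n + 1)

/-- The same telescoping, with `v k` as 1/(1 - x^(2k+1)). The terms with s > 0 are divisible by
x^(2n+1). -/
theorem gauss_psi_finite {R : Type*} [CommRing R] (x : R) (v : ℕ → R)
    (hv : ∀ k, (1 - x ^ (2 * k + 1)) * v k = 1) (n : ℕ) :
    ∑ s ∈ range (n + 1),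
        (∏ k ∈ Ico s n, (1 - x ^ (2 * k + 2)) * v k) * x ^ (s * (2 * n + 1)) =
      ∑ s ∈ range (2 * n + 1), x ^ (s * (s + 1) / 2) := by
  induction n with
  | zero => simp
  | succ n ih =>
    have tel : ∀ t ≤ n, (1 - x ^ (2 * n + 1)) * ∑ s ∈ range (t + 1),
        (((∏ k ∈ Ico s n, (1 - x ^ (2 * k + 2)) * v k) * ((1 - x ^ (2 * n + 2)) * v n)) *
          x ^ (s * (2 * n + 3)) -
        (∏ k ∈ Ico s n, (1 - x ^ (2 * k + 2)) * v k) * x ^ (s * (2 * n + 1))) =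
        (∏ k ∈ Ico t n, (1 - x ^ (2 * k + 2)) * v k) * (1 - x ^ (2 * t + 1)) *
          x ^ ((t + 1) * (2 * n + 1)) := by
      intro t
      induction t with
      | zero =>
        intro _
        simp only [zero_add, sum_range_one]
        generalize (∏ k ∈ Ico 0 n, (1 - x ^ (2 * k + 2)) * v k) = P
        linear_combination (P * (1 - x ^ (2 * n + 2))) * hv n
      | succ t iht =>
        intro ht
        rw [sum_range_succ, mul_add, iht (by omega), prod_eq_prod_Ico_succ_bot (by omega : t < n)]
        generalize (∏ k ∈ Ico (t + 1) n, (1 - x ^ (2 * k + 2)) * v k) = P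
        linear_combination (P * (1 - x ^ (2 * n + 2)) * x ^ ((t + 1) * (2 * n + 3))) * hv n +
          (1 - x ^ (2 * t + 2)) * P * x ^ ((t + 1) * (2 * n + 1)) * hv t
    have key := tel n le_rfl
    rw [sum_sub_distrib, ih, Ico_self, prod_empty] at key
    rw [sum_range_succ, show 2 * (n + 1) + 1 = 2 * n + 1 + 1 + 1 by ring,
      sum_range_succ _ (2 * n + 1 + 1), sum_range_succ _ (2 * n + 1), Ico_self, prod_empty]
    have e : ∀ s ∈ range (n + 1),
        (∏ k ∈ Ico s (n + 1), (1 - x ^ (2 * k + 2)) * v k) * x ^ (s * (2 * n + 1 + 1 + 1)) =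
        ((∏ k ∈ Ico s n, (1 - x ^ (2 * k + 2)) * v k) * ((1 - x ^ (2 * n + 2)) * v n)) *
          x ^ (s * (2 * n + 3)) := by
      intro s hs
      rw [prod_Ico_succ_top (by have := mem_range.1 hs; omega)]
    rw [sum_congr rfl e,
      show (2 * n + 1) * (2 * n + 1 + 1) / 2 = (n + 1) * (2 * n + 1) from
        Nat.div_eq_of_eq_mul_left two_pos (by ring),
      show (2 * n + 1 + 1) * (2 * n + 1 + 1 + 1) / 2 = (n + 1) * (2 * n + 3) from
        Nat.div_eq_of_eq_mul_left two_pos (by ring)]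
    generalize (∑ s ∈ range (n + 1),
        ((∏ k ∈ Ico s n, (1 - x ^ (2 * k + 2)) * v k) * ((1 - x ^ (2 * n + 2)) * v n)) *
          x ^ (s * (2 * n + 3))) = A at *
    generalize ∑ s ∈ range (2 * n + 1), x ^ (s * (s + 1) / 2) = B at *
    linear_combination v n * key - (A - B - x ^ ((n + 1) * (2 * n + 1))) * hv n

/-! ### Cubic norms of infinite products -/

/-- The substitution `X ↦ X ^ 3` on complex power series. -/
def triple : ℂ⟦X⟧ →ₐ[ℂ] ℂ⟦X⟧ := PowerSeries.expand 3 three_ne_zero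

/-- The cubic norm `f(X) f(ωX) f(ω²X)`. -/
def cubicNorm (ω : ℂ) (f : ℂ⟦X⟧) : ℂ⟦X⟧ :=
  f * PowerSeries.rescale ω f * PowerSeries.rescale (ω ^ 2) f

theorem cubicNorm_mul (ω : ℂ) (f g : ℂ⟦X⟧) :
    cubicNorm ω (f * g) = cubicNorm ω f * cubicNorm ω g := by
  simp only [cubicNorm, map_mul]; ring

theorem cubicNorm_one (ω : ℂ) : cubicNorm ω 1 = 1 := by simp [cubicNorm]

theorem rescale_triple {c : ℂ} (hc : c ^ 3 = 1) (f : ℂ⟦X⟧) :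
    PowerSeries.rescale c (triple f) = triple f := by
  ext n
  rw [PowerSeries.coeff_rescale, triple, PowerSeries.coeff_expand]
  split_ifs with h
  · obtain ⟨m, rfl⟩ := h
    rw [pow_mul, hc, one_pow, one_mul]
  · simp

theorem cubicNorm_triple {ω : ℂ} (hω : ω ^ 3 = 1) (f : ℂ⟦X⟧) :
    cubicNorm ω (triple f) = triple f ^ 3 := by
  rw [cubicNorm, rescale_triple hω, rescale_triple (by rw [← pow_mul, mul_comm, pow_mul, hω, one_pow])]
  ring

/-- The conditions on the factors of an infinite product `∏ a k` under which its cubic norm can be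
evaluated. -/
structure IsCubicFactor (ω : ℂ) (a : ℕ → ℂ⟦X⟧) : Prop where
  norm_eq : ∀ k, ¬ 3 ∣ k → cubicNorm ω (a k) = triple (a k)
  mul_three : ∀ k, a (3 * k) = triple (a k)

theorem IsCubicFactor.mul {ω : ℂ} {a b : ℕ → ℂ⟦X⟧} (ha : IsCubicFactor ω a)
    (hb : IsCubicFactor ω b) : IsCubicFactor ω fun k => a k * b k where
  norm_eq k hk := by rw [cubicNorm_mul, ha.norm_eq k hk, hb.norm_eq k hk, map_mul]
  mul_three k := by rw [ha.mul_three, hb.mul_three, map_mul]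

theorem inv_eq_of_mul_eq_one {F : Type*} [Field F] {u v : F⟦X⟧}
    (h : PowerSeries.constantCoeff u = 1) (huv : u * v = 1) : v = u⁻¹ := by
  have h1 : u * u⁻¹ = 1 := PowerSeries.mul_inv_cancel _ (by simp [h])
  linear_combination u⁻¹ * huv - v * h1

theorem triple_inv {u : ℂ⟦X⟧} (h : PowerSeries.constantCoeff u = 1) :
    triple u⁻¹ = (triple u)⁻¹ := by
  refine inv_eq_of_mul_eq_one (by rw [triple, PowerSeries.constantCoeff_expand, h]) ?_
  rw [← map_mul, PowerSeries.mul_inv_cancel _ (by simp [h]), map_one]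

theorem cubicNorm_inv {ω : ℂ} {u : ℂ⟦X⟧} (h : PowerSeries.constantCoeff u = 1)
    (hu : cubicNorm ω u = triple u) : cubicNorm ω u⁻¹ = triple u⁻¹ := by
  rw [triple_inv h]
  refine inv_eq_of_mul_eq_one (by rw [triple, PowerSeries.constantCoeff_expand, h]) ?_
  rw [← hu, ← cubicNorm_mul, PowerSeries.mul_inv_cancel _ (by simp [h]), cubicNorm_one]

theorem rescale_binomial {R : Type*} [CommRing R] (c d : R) (k : ℕ) :
    PowerSeries.rescale c (1 + PowerSeries.C d * PowerSeries.X ^ k) =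
      1 + PowerSeries.C d * PowerSeries.C (c ^ k) * PowerSeries.X ^ k := by
  have h : PowerSeries.rescale c (PowerSeries.C d) = PowerSeries.C d := by
    ext n
    rw [PowerSeries.coeff_rescale, PowerSeries.coeff_C]
    split_ifs with hn
    · simp [hn]
    · simp
  rw [map_add, map_one, map_mul, map_pow, h, PowerSeries.rescale_X, mul_pow, map_pow]
  ring

theorem triple_binomial (c : ℂ) (k : ℕ) :
    triple (1 + PowerSeries.C c * PowerSeries.X ^ k) =
      1 + PowerSeries.C c * PowerSeries.X ^ (3 * k) := by
  simp only [triple, map_add, map_mul, map_one, map_pow, PowerSeries.expand_C,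
    PowerSeries.expand_X]
  ring

/-- For k prime to 3, η = ω^k is again a primitive cube root of unity, and (1 + cT)(1 + cηT)(1 +
cη²T) = 1 + c³T³. The condition c³ = c covers the signs c = ±1. -/
theorem cubicNorm_binomial {ω : ℂ} (hω : IsPrimitiveRoot ω 3) {c : ℂ} (hc : c ^ 3 = c) {k : ℕ}
    (hk : ¬ 3 ∣ k) :
    cubicNorm ω (1 + PowerSeries.C c * PowerSeries.X ^ k) =
      triple (1 + PowerSeries.C c * PowerSeries.X ^ k) := by
  have hη : IsPrimitiveRoot (ω ^ k) 3 :=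
    hω.pow_of_coprime k ((Nat.Prime.coprime_iff_not_dvd Nat.prime_three).2 hk).symm
  have h1 : (ω ^ k) ^ 2 + ω ^ k + 1 = 0 := by
    have h := hη.geom_sum_eq_zero (by norm_num)
    simp only [sum_range_succ, range_zero, sum_empty] at h
    linear_combination h
  have h2 : PowerSeries.C (ω ^ k) ^ 2 + PowerSeries.C (ω ^ k) + 1 = (0 : ℂ⟦X⟧) := by
    simpa using congrArg (PowerSeries.C (R := ℂ)) h1
  have h3 : PowerSeries.C c ^ 3 = PowerSeries.C c := by rw [← map_pow, hc]
  rw [triple_binomial, cubicNorm, rescale_binomial, rescale_binomial, ← pow_mul, mul_comm 2 k,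
    pow_mul ω, map_pow _ (ω ^ k) 2, mul_comm 3 k, pow_mul _ k 3]
  generalize PowerSeries.C (ω ^ k) = z at *
  generalize (PowerSeries.X : ℂ⟦X⟧) ^ k = T at *
  generalize (PowerSeries.C c) = d at *
  linear_combination (d * T + d ^ 2 * T ^ 2 * z + d ^ 3 * T ^ 3 * (z - 1)) * h2 + T ^ 3 * h3

theorem constantCoeff_binomial {R : Type*} [CommRing R] (c : R) {k : ℕ} (hk : k ≠ 0) :
    PowerSeries.constantCoeff (1 + PowerSeries.C c * PowerSeries.X ^ k) = 1 := by
  simp [hk]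

/-- The partial products `∏_{0 < k ≤ 2n} a k`, along even numbers of factors, converge to `f`. -/
def EvenPartialProdTendsto {F : Type*} [Field F] (a : ℕ → F⟦X⟧) (f : F⟦X⟧) : Prop :=
  ∀ N : ℕ, ∃ M : ℕ, ∀ n ≥ M, PowerSeries.X ^ N ∣ f - ∏ k ∈ range (2 * n), a (k + 1)

/-- Factors with index prime to 3 have norm `triple (a k)`. A factor of index 3k is already a series
in X³, so its norm is its cube. The factor `triple (triple _)` on the left avoids a division. -/
theorem IsCubicFactor.prod {ω : ℂ} (hω : ω ^ 3 = 1) {a : ℕ → ℂ⟦X⟧} (ha : IsCubicFactor ω a)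
    (n : ℕ) :
    cubicNorm ω (∏ k ∈ range (3 * n), a (k + 1)) * triple (triple (∏ k ∈ range n, a (k + 1))) =
      triple (∏ k ∈ range (3 * n), a (k + 1)) * triple (∏ k ∈ range n, a (k + 1)) ^ 3 := by
  induction n with
  | zero => simp [cubicNorm_one]
  | succ n ih =>
    have e1 := ha.norm_eq (3 * n + 1) (by omega)
    have e2 := ha.norm_eq (3 * n + 1 + 1) (by omega)
    have e3 := ha.mul_three (n + 1)
    have e4 := cubicNorm_triple hω (a (n + 1))
    rw [show 3 * (n + 1) = 3 * n + 1 + 1 + 1 by ring] at e3 ⊢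
    simp only [prod_range_succ, cubicNorm_mul, map_mul, e1, e2, e3, e4]
    linear_combination (triple (a (3 * n + 1)) * triple (a (3 * n + 1 + 1)) *
      triple (a (n + 1)) ^ 3 * triple (triple (a (n + 1)))) * ih

theorem eq_of_forall_X_pow_dvd_sub {R : Type*} [CommRing R] {f g : R⟦X⟧}
    (h : ∀ N : ℕ, PowerSeries.X ^ N ∣ f - g) : f = g := by
  ext n
  have := PowerSeries.X_pow_dvd_iff.1 (h (n + 1)) n (Nat.lt_succ_self n)
  rwa [map_sub, sub_eq_zero] at this

theorem X_pow_dvd_rescale {R : Type*} [CommRing R] {N : ℕ} (c : R) {f : R⟦X⟧}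
    (h : PowerSeries.X ^ N ∣ f) : PowerSeries.X ^ N ∣ PowerSeries.rescale c f := by
  rw [PowerSeries.X_pow_dvd_iff] at h ⊢
  intro m hm
  rw [PowerSeries.coeff_rescale, h m hm, mul_zero]

theorem X_pow_dvd_triple {N : ℕ} {f : ℂ⟦X⟧} (h : PowerSeries.X ^ N ∣ f) :
    PowerSeries.X ^ N ∣ triple f := by
  refine dvd_trans ?_ (map_dvd triple h)
  rw [map_pow, triple, PowerSeries.expand_X, ← pow_mul]
  exact pow_dvd_pow _ (by omega)

theorem cubicNorm_limit {ω : ℂ} (hω : ω ^ 3 = 1) {a : ℕ → ℂ⟦X⟧} (ha : IsCubicFactor ω a)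
    {f : ℂ⟦X⟧} (hf : EvenPartialProdTendsto a f) :
    cubicNorm ω f * triple (triple f) = triple f ^ 4 := by
  refine eq_of_forall_X_pow_dvd_sub fun N => ?_
  obtain ⟨M, hM⟩ := hf N
  have h1 := hM M le_rfl
  -- The finite identity compares 3n factors with n; n = 2M makes both counts even.
  have h3 := hM (3 * M) (by omega)
  rw [show 2 * (3 * M) = 3 * (2 * M) by ring] at h3
  have key := ha.prod hω (2 * M)
  generalize (∏ k ∈ range (3 * (2 * M)), a (k + 1)) = P at *
  generalize (∏ k ∈ range (2 * M), a (k + 1)) = Q at *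
  have mk : ∀ {u v : ℂ⟦X⟧}, PowerSeries.X ^ N ∣ u - v →
      Ideal.Quotient.mk (Ideal.span {(PowerSeries.X : ℂ⟦X⟧) ^ N}) u =
      Ideal.Quotient.mk (Ideal.span {(PowerSeries.X : ℂ⟦X⟧) ^ N}) v := fun h => by
    rwa [Ideal.Quotient.eq, Ideal.mem_span_singleton]
  rw [← Ideal.mem_span_singleton, ← Ideal.Quotient.eq]
  have r (c : ℂ) := mk (u := PowerSeries.rescale c f) (v := PowerSeries.rescale c P)
    (by rw [← map_sub]; exact X_pow_dvd_rescale c h3)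
  have t1 := mk (u := triple f) (v := triple Q) (by rw [← map_sub]; exact X_pow_dvd_triple h1)
  have t3 := mk (u := triple f) (v := triple P) (by rw [← map_sub]; exact X_pow_dvd_triple h3)
  have tt1 := mk (u := triple (triple f)) (v := triple (triple Q))
    (by rw [← map_sub, ← map_sub]; exact X_pow_dvd_triple (X_pow_dvd_triple h1))
  have key' := congrArg (Ideal.Quotient.mk (Ideal.span {(PowerSeries.X : ℂ⟦X⟧) ^ N})) key
  simp only [cubicNorm, map_mul, map_pow] at key' ⊢
  rw [mk h3, r, r, tt1, key', ← t3, ← t1]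
  ring

theorem map_dilate_three (f : ℚ⟦X⟧) :
    PowerSeries.map (algebraMap ℚ ℂ) (dilate 3 f) = triple (PowerSeries.map (algebraMap ℚ ℂ) f) :=
  PowerSeries.map_expand _ _ _ _

theorem dilate_three_dilate_three (f : ℚ⟦X⟧) : dilate 3 (dilate 3 f) = dilate 9 f := by
  rw [dilate, dilate, dilate, ← PowerSeries.expand_mul]

/-- A power series that is the limit of a product of cubic factors, dissected by exponents modulo
three into two parts, satisfies a cubic relation with its dilates. -/
theorem cubic_relation {ω : ℂ} (hω : IsPrimitiveRoot ω 3) {a : ℕ → ℂ⟦X⟧}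
    (ha : IsCubicFactor ω a) {f u v : ℚ⟦X⟧} (hfuv : f = u + v)
    (hf : EvenPartialProdTendsto a (PowerSeries.map (algebraMap ℚ ℂ) f))
    (hu : ∀ n, n % 3 ≠ 0 → PowerSeries.coeff n u = 0)
    (hv : ∀ n, n % 3 ≠ 1 → PowerSeries.coeff n v = 0) :
    (u ^ 3 + v ^ 3) * dilate 9 f = dilate 3 f ^ 4 := by
  have hω3 : ω ^ 3 = 1 := hω.pow_eq_one
  have key := cubicNorm_limit hω3 ha hf
  rw [← map_dilate_three, ← map_dilate_three, dilate_three_dilate_three] at key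
  have hur : ∀ c : ℂ, c ^ 3 = 1 → PowerSeries.rescale c (PowerSeries.map (algebraMap ℚ ℂ) u) =
      PowerSeries.map (algebraMap ℚ ℂ) u := by
    intro c hc
    ext n
    rw [PowerSeries.coeff_rescale, PowerSeries.coeff_map]
    by_cases h : n % 3 = 0
    · obtain ⟨m, rfl⟩ := Nat.dvd_of_mod_eq_zero h
      rw [pow_mul, hc, one_pow, one_mul]
    · simp [hu n h]
  have hvr : ∀ c : ℂ, c ^ 3 = 1 → PowerSeries.rescale c (PowerSeries.map (algebraMap ℚ ℂ) v) =
      PowerSeries.C c * PowerSeries.map (algebraMap ℚ ℂ) v := by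
    intro c hc
    ext n
    rw [PowerSeries.coeff_rescale, PowerSeries.coeff_C_mul, PowerSeries.coeff_map]
    by_cases h : n % 3 = 1
    · rw [← Nat.div_add_mod n 3, h, pow_succ, pow_mul, hc, one_pow, one_mul]
    · simp [hv n h]
  have h1 : ω ^ 2 + ω + 1 = 0 := by
    have h := hω.geom_sum_eq_zero (by norm_num)
    simp only [sum_range_succ, range_zero, sum_empty] at h
    linear_combination h
  have h2 : PowerSeries.C ω ^ 2 + PowerSeries.C ω + 1 = (0 : ℂ⟦X⟧) := by
    simpa using congrArg (PowerSeries.C (R := ℂ)) h1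
  have hω6 : (ω ^ 2) ^ 3 = 1 := by rw [← pow_mul, mul_comm, pow_mul, hω3, one_pow]
  -- The conjugates of f are u + v, u + ωv and u + ω²v.
  have hN : cubicNorm ω (PowerSeries.map (algebraMap ℚ ℂ) f) =
      PowerSeries.map (algebraMap ℚ ℂ) (u ^ 3 + v ^ 3) := by
    rw [cubicNorm, hfuv]
    simp only [map_add, map_pow]
    rw [hur ω hω3, hvr ω hω3, hur _ hω6, hvr _ hω6, map_pow]
    generalize PowerSeries.map (algebraMap ℚ ℂ) u = U
    generalize PowerSeries.map (algebraMap ℚ ℂ) v = V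
    generalize PowerSeries.C ω = z at *
    linear_combination (U ^ 2 * V + U * V ^ 2 * z + V ^ 3 * (z - 1)) * h2
  rw [hN, ← map_mul, ← map_pow] at key
  exact PowerSeries.map_injective _ (algebraMap ℚ ℂ).injective key

/-! ### Product expansions of φ(-q) and ψ(q) -/

/-- The factors `(1 - X ^ k) / (1 + X ^ k)` of the product expansion of `φ(-q)`. -/
def phiFactor (k : ℕ) : ℂ⟦X⟧ := (1 - PowerSeries.X ^ k) * (1 + PowerSeries.X ^ k)⁻¹

/-- The factors `(1 - X ^ k) ^ ((-1) ^ k)` of the product expansion of `ψ(q)`. -/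
def psiFactor (k : ℕ) : ℂ⟦X⟧ :=
  if Even k then 1 - PowerSeries.X ^ k else (1 - PowerSeries.X ^ k)⁻¹

theorem one_add_X_pow_eq (k : ℕ) :
    (1 + PowerSeries.X ^ k : ℂ⟦X⟧) = 1 + PowerSeries.C 1 * PowerSeries.X ^ k := by simp

theorem one_sub_X_pow_eq (k : ℕ) :
    (1 - PowerSeries.X ^ k : ℂ⟦X⟧) = 1 + PowerSeries.C (-1) * PowerSeries.X ^ k := by
  simp [sub_eq_add_neg]

theorem binomial_inv_three_mul (c : ℂ) (k : ℕ) :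
    (1 + PowerSeries.C c * PowerSeries.X ^ (3 * k) : ℂ⟦X⟧)⁻¹ =
      triple (1 + PowerSeries.C c * PowerSeries.X ^ k)⁻¹ := by
  rw [← triple_binomial]
  -- For k = 0 the binomial is the constant 1 + c, possibly zero, so `triple_inv` does not apply.
  rcases Nat.eq_zero_or_pos k with rfl | hk
  · have : (1 + PowerSeries.C c * PowerSeries.X ^ 0 : ℂ⟦X⟧) = PowerSeries.C (1 + c) := by simp
    rw [this, triple, PowerSeries.expand_C, PowerSeries.C_inv, PowerSeries.expand_C]
  · rw [triple_inv (constantCoeff_binomial c hk.ne')]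

theorem isCubicFactor_phiFactor {ω : ℂ} (hω : IsPrimitiveRoot ω 3) :
    IsCubicFactor ω phiFactor := by
  refine IsCubicFactor.mul ⟨fun k hk => ?_, fun k => ?_⟩ ⟨fun k hk => ?_, fun k => ?_⟩
  · rw [one_sub_X_pow_eq, cubicNorm_binomial hω (by norm_num) hk]
  · rw [one_sub_X_pow_eq, one_sub_X_pow_eq, triple_binomial]
  · rw [one_add_X_pow_eq]
    exact cubicNorm_inv (constantCoeff_binomial _ (by rintro rfl; simp at hk))
      (cubicNorm_binomial hω (by norm_num) hk)
  · rw [one_add_X_pow_eq, one_add_X_pow_eq, binomial_inv_three_mul]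

theorem isCubicFactor_psiFactor {ω : ℂ} (hω : IsPrimitiveRoot ω 3) :
    IsCubicFactor ω psiFactor := by
  refine ⟨fun k hk => ?_, fun k => ?_⟩
  · have h := cubicNorm_binomial hω (c := -1) (by norm_num) hk
    rw [psiFactor]
    split_ifs
    · rw [one_sub_X_pow_eq, h]
    · rw [one_sub_X_pow_eq]
      exact cubicNorm_inv (constantCoeff_binomial _ (by rintro rfl; simp at hk)) h
  · have hp : Even (3 * k) ↔ Even k := by rw [Nat.even_mul]; simp [show ¬ Even 3 by decide]
    simp only [psiFactor, hp]
    split_ifs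
    · rw [one_sub_X_pow_eq, one_sub_X_pow_eq, triple_binomial]
    · rw [one_sub_X_pow_eq, one_sub_X_pow_eq, binomial_inv_three_mul]

theorem prod_psiFactor (n : ℕ) :
    ∏ k ∈ range (2 * n), psiFactor (k + 1) =
      ∏ k ∈ Ico 0 n, (1 - PowerSeries.X ^ (2 * k + 2)) *
        (1 - PowerSeries.X ^ (2 * k + 1) : ℂ⟦X⟧)⁻¹ := by
  rw [← range_eq_Ico]
  induction n with
  | zero => simp
  | succ n ih =>
    rw [show 2 * (n + 1) = 2 * n + 1 + 1 by ring, prod_range_succ, prod_range_succ, ih,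
      prod_range_succ, psiFactor, psiFactor, if_neg (by simp [parity_simps]),
      if_pos (by simp [parity_simps])]
    ring

theorem X_pow_dvd_sub_sum_range {R : Type*} [CommRing R] (x : R) (m n : ℕ)
    (c : ℕ → R) : x ^ n ∣ ∑ s ∈ range (m + 1), c s * x ^ (s * (n + 1)) - c 0 := by
  rw [sum_range_succ']
  simp only [zero_mul, pow_zero, mul_one, add_sub_cancel_right]
  refine dvd_sum fun s _ => Dvd.dvd.mul_left (pow_dvd_pow x ?_) _
  nlinarith

theorem X_pow_dvd_psi_sub (n : ℕ) :
    PowerSeries.X ^ n ∣ psi - ∑ s ∈ range (2 * n + 1), PowerSeries.X ^ (s * (s + 1) / 2) := by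
  rw [PowerSeries.X_pow_dvd_iff]
  intro m hm
  rw [map_sub, map_sum, psi, PowerSeries.coeff_mk, sub_eq_zero]
  simp only [PowerSeries.coeff_X_pow]
  rw [sum_boole]
  congr 1
  rw [← Set.ncard_coe_finset]
  congr 1
  ext k
  simp only [Set.mem_ofPred_eq, coe_filter, mem_range]
  refine ⟨fun h => ⟨?_, h.symm⟩, fun h => h.2.symm⟩
  have : k * 2 / 2 ≤ k * (k + 1) / 2 + 1 := by
    rcases k with _ | k
    · simp
    · have := Nat.div_le_div_right (c := 2) (show (k + 1) * 2 ≤ (k + 1) * (k + 1 + 1) by nlinarith)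
      omega
  rw [Nat.mul_div_cancel _ two_pos] at this
  omega

theorem X_pow_dvd_phiNeg_sub (n : ℕ) :
    PowerSeries.X ^ n ∣ phiNeg - (2 * ∑ s ∈ range (n + 1),
      (-1) ^ s * PowerSeries.X ^ (s ^ 2) - 1) := by
  have h := Finset.sum_Icc_of_even_eq_range
    (f := fun k : ℤ => (-1 : ℚ⟦X⟧) ^ k.natAbs * PowerSeries.X ^ (k.natAbs ^ 2))
    (fun k => by simp) n
  simp only [Int.natAbs_natCast, Int.natAbs_zero, nsmul_eq_mul, Nat.cast_ofNat] at h
  rw [show (-1 : ℚ⟦X⟧) ^ 0 * PowerSeries.X ^ 0 ^ 2 = 1 by simp] at h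
  rw [← h, PowerSeries.X_pow_dvd_iff]
  intro m hm
  -- k and k² have the same parity, so the sign (-1)^k is the one produced by q ↦ -q.
  have hc : ∀ k : ℤ, PowerSeries.coeff m ((-1 : ℚ⟦X⟧) ^ k.natAbs * PowerSeries.X ^ (k.natAbs ^ 2)) =
      (-1) ^ m * if k ^ 2 = (m : ℤ) then 1 else 0 := by
    intro k
    have hk : k ^ 2 = (m : ℤ) ↔ m = k.natAbs ^ 2 := by
      rw [← Int.natAbs_sq]; norm_cast; exact eq_comm
    rw [show (-1 : ℚ⟦X⟧) ^ k.natAbs = PowerSeries.C ((-1) ^ k.natAbs) by simp,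
      PowerSeries.coeff_C_mul, PowerSeries.coeff_X_pow]
    simp only [hk]
    split_ifs with hm'
    · rw [hm', neg_one_pow_congr (show Even k.natAbs ↔ Even (k.natAbs ^ 2) by simp [parity_simps])]
    · simp
  rw [map_sub, map_sum, phiNeg, PowerSeries.evalNegHom, PowerSeries.coeff_rescale, phi,
    PowerSeries.coeff_mk, sub_eq_zero]
  simp only [hc]
  rw [← mul_sum, sum_boole]
  congr 2
  rw [← Set.ncard_coe_finset]
  congr 1
  ext k
  simp only [Set.mem_ofPred_eq, coe_filter, mem_Icc]
  refine ⟨fun h => ⟨?_, h⟩, fun h => h.2⟩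
  rw [← abs_le]
  have : |k| ≤ k ^ 2 := by
    rw [← sq_abs]; nlinarith [abs_nonneg k, Int.abs_lt_one_iff (a := k)]
  omega

theorem evenPartialProdTendsto_psi :
    EvenPartialProdTendsto psiFactor (PowerSeries.map (algebraMap ℚ ℂ) psi) := by
  refine fun N => ⟨N, fun n hn => ?_⟩
  have h1 := map_dvd (PowerSeries.map (algebraMap ℚ ℂ)) (X_pow_dvd_psi_sub n)
  simp only [map_sub, map_sum, map_pow, PowerSeries.map_X] at h1
  have h2 := gauss_psi_finite (PowerSeries.X : ℂ⟦X⟧) (fun k => (1 - PowerSeries.X ^ (2 * k + 1))⁻¹)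
    (fun k => PowerSeries.mul_inv_cancel _ (by simp)) n
  have h3 := X_pow_dvd_sub_sum_range (PowerSeries.X : ℂ⟦X⟧) n (2 * n) fun s =>
    ∏ k ∈ Ico s n, (1 - PowerSeries.X ^ (2 * k + 2)) * (1 - PowerSeries.X ^ (2 * k + 1))⁻¹
  rw [h2] at h3
  have h4 := dvd_add h1 ((pow_dvd_pow _ (by omega)).trans h3)
  rw [prod_psiFactor]
  exact (pow_dvd_pow _ hn).trans (by simpa using h4)

theorem evenPartialProdTendsto_phiNeg :
    EvenPartialProdTendsto phiFactor (PowerSeries.map (algebraMap ℚ ℂ) phiNeg) := by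
  refine fun N => ⟨N, fun n hn => ?_⟩
  have h1 := map_dvd (PowerSeries.map (algebraMap ℚ ℂ)) (X_pow_dvd_phiNeg_sub (2 * n))
  simp only [map_sub, map_sum, map_pow, PowerSeries.map_X, map_mul, map_neg, map_one,
    map_ofNat] at h1
  have hv : ∀ k : ℕ, (1 + PowerSeries.X ^ k : ℂ⟦X⟧) * (1 + PowerSeries.X ^ k)⁻¹ = 1 := fun k =>
    PowerSeries.mul_inv_cancel _ (by
      rcases Nat.eq_zero_or_pos k with rfl | hk
      · rw [pow_zero, map_add, map_one]; norm_num
      · simp [hk.ne'])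
  have h2 := gauss_phi_finite (PowerSeries.X : ℂ⟦X⟧) (fun k => (1 + PowerSeries.X ^ k)⁻¹) hv (2 * n)
  have h3 := X_pow_dvd_sub_sum_range (PowerSeries.X : ℂ⟦X⟧) (2 * n) (2 * n) fun s =>
    2 * (-1) ^ s * (1 + PowerSeries.X ^ s)⁻¹ *
      ∏ k ∈ Ico s (2 * n), (1 - PowerSeries.X ^ (k + 1)) * (1 + PowerSeries.X ^ (k + 1))⁻¹
  rw [h2] at h3
  have h4 := (pow_dvd_pow _ (by omega : N ≤ 2 * n)).trans (dvd_add h1 h3)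
  have h5 : (2 : ℂ⟦X⟧) * (1 + PowerSeries.X ^ 0)⁻¹ = 1 := by
    have := hv 0; rw [pow_zero] at this ⊢; linear_combination this
  rw [pow_zero, mul_one, h5, one_mul] at h4
  simp only [phiFactor]
  rw [range_eq_Ico]
  convert h4 using 1
  ring

/-! ### Coefficients and dissection modulo 3 -/

theorem coeff_phiNeg (n : ℕ) :
    PowerSeries.coeff n phiNeg = (-1) ^ n * (Set.ncard {k : ℤ | k ^ 2 = (n : ℤ)} : ℚ) := by
  rw [phiNeg, PowerSeries.evalNegHom, PowerSeries.coeff_rescale, phi, PowerSeries.coeff_mk]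

theorem coeff_psi (n : ℕ) :
    PowerSeries.coeff n psi = (Set.ncard {k : ℕ | k * (k + 1) / 2 = n} : ℚ) := by
  rw [psi, PowerSeries.coeff_mk]

theorem constantCoeff_phiNeg : PowerSeries.constantCoeff phiNeg = 1 := by
  rw [← PowerSeries.coeff_zero_eq_constantCoeff_apply, coeff_phiNeg]
  simp

theorem constantCoeff_psi : PowerSeries.constantCoeff psi = 1 := by
  rw [← PowerSeries.coeff_zero_eq_constantCoeff_apply, coeff_psi]
  have : {k : ℕ | k * (k + 1) / 2 = 0} = {0} := by
    ext k
    simp only [Set.mem_ofPred_eq, Set.mem_singleton_iff]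
    refine ⟨fun h => ?_, fun h => by simp [h]⟩
    by_contra hk
    have : 2 ≤ k * (k + 1) := by nlinarith [Nat.pos_of_ne_zero hk]
    omega
  rw [this, Set.ncard_singleton, Nat.cast_one]

theorem coeff_one_phiNeg : PowerSeries.coeff 1 phiNeg = -2 := by
  have : {k : ℤ | k ^ 2 = ((1 : ℕ) : ℤ)} = {1, -1} := by
    ext k; simp
  rw [coeff_phiNeg, this, Set.ncard_pair (by norm_num)]
  norm_num

theorem coeff_dilate (m : ℕ) [NeZero m] (f : ℚ⟦X⟧) (n : ℕ) :
    PowerSeries.coeff n (dilate m f) = if m ∣ n then PowerSeries.coeff (n / m) f else 0 := by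
  rw [dilate, PowerSeries.coeff_expand]

/-- Squares are 0 or 1 modulo 3, and those divisible by 3 are the (3j)² = 9j², which make up φ(-q⁹);
the signs match since 9 is odd. -/
theorem coeff_phiNeg_sub_dilate {n : ℕ} (hn : n % 3 ≠ 1) :
    PowerSeries.coeff n (phiNeg - dilate 9 phiNeg) = 0 := by
  rw [map_sub, coeff_dilate]
  split_ifs with h
  · obtain ⟨m, rfl⟩ := h
    have : {k : ℤ | k ^ 2 = ((9 * m : ℕ) : ℤ)} = (fun k => 3 * k) '' {k : ℤ | k ^ 2 = (m : ℤ)} := by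
      ext k
      simp only [Set.mem_ofPred_eq, Set.mem_image]
      constructor
      · intro hk
        have h3 : (3 : ℤ) ∣ k := Int.prime_three.dvd_of_dvd_pow
          (n := 2) ⟨3 * m, by rw [hk]; push_cast; ring⟩
        obtain ⟨j, rfl⟩ := h3
        exact ⟨j, by push_cast at hk; linarith, rfl⟩
      · rintro ⟨j, hj, rfl⟩
        push_cast
        rw [← hj]; ring
    rw [Nat.mul_div_cancel_left _ (by norm_num), coeff_phiNeg, coeff_phiNeg, this,
      Set.ncard_image_of_injective _ (fun a b hab => by simpa using hab), pow_mul]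
    norm_num
  · have : {k : ℤ | k ^ 2 = (n : ℤ)} = ∅ := by
      ext k
      simp only [Set.mem_ofPred_eq, Set.mem_empty_iff_false, iff_false]
      intro hk
      obtain ⟨j, rfl | rfl | rfl⟩ : ∃ j, k = 3 * j ∨ k = 3 * j + 1 ∨ k = 3 * j + 2 :=
        ⟨k / 3, by omega⟩
      · ring_nf at hk; omega
      · ring_nf at hk; omega
      · ring_nf at hk; omega
    rw [coeff_phiNeg, this]
    simp

/-- Triangular numbers are 0 or 1 modulo 3. Class 1 arises exactly from k = 3j + 1, where T(3j+1) =
9T(j) + 1, and makes up qψ(q⁹). -/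
theorem coeff_psi_sub_dilate {n : ℕ} (hn : n % 3 ≠ 0) :
    PowerSeries.coeff n (psi - PowerSeries.X * dilate 9 psi) = 0 := by
  obtain ⟨n, rfl⟩ := Nat.exists_eq_succ_of_ne_zero (show n ≠ 0 by rintro rfl; simp at hn)
  rw [map_sub, Nat.succ_eq_add_one, PowerSeries.coeff_succ_X_mul, coeff_dilate]
  have tri : ∀ k m : ℕ, k * (k + 1) / 2 = m ↔ k * (k + 1) = 2 * m := by
    intro k m
    have := Nat.even_mul_succ_self k
    rw [even_iff_two_dvd] at this
    omega
  simp only [coeff_psi, tri]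
  split_ifs with h
  · obtain ⟨m, rfl⟩ := h
    have : {k : ℕ | k * (k + 1) = 2 * (9 * m + 1)} =
        (fun k => 3 * k + 1) '' {k : ℕ | k * (k + 1) = 2 * m} := by
      ext k
      simp only [Set.mem_ofPred_eq, Set.mem_image]
      constructor
      · intro hk
        obtain ⟨j, rfl | rfl | rfl⟩ : ∃ j, k = 3 * j ∨ k = 3 * j + 1 ∨ k = 3 * j + 2 :=
          ⟨k / 3, by omega⟩
        · ring_nf at hk; omega
        · exact ⟨j, by ring_nf at hk ⊢; omega, rfl⟩
        · ring_nf at hk; omega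
      · rintro ⟨j, hj, rfl⟩
        linear_combination 9 * hj
    rw [Nat.mul_div_cancel_left _ (by norm_num), this,
      Set.ncard_image_of_injective _ (fun a b hab => by simpa using hab), sub_self]
  · have : {k : ℕ | k * (k + 1) = 2 * (n + 1)} = ∅ := by
      ext k
      simp only [Set.mem_ofPred_eq, Set.mem_empty_iff_false, iff_false]
      intro hk
      obtain ⟨j, rfl | rfl | rfl⟩ : ∃ j, k = 3 * j ∨ k = 3 * j + 1 ∨ k = 3 * j + 2 :=
        ⟨k / 3, by omega⟩
      · ring_nf at hk; omega
      · ring_nf at hk; omega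
      · ring_nf at hk; omega
    rw [this]
    simp

theorem phiNeg_cubic_relation :
    (dilate 9 phiNeg ^ 3 + (phiNeg - dilate 9 phiNeg) ^ 3) * dilate 9 phiNeg =
      dilate 3 phiNeg ^ 4 := by
  have hω := Complex.isPrimitiveRoot_exp 3 three_ne_zero
  refine cubic_relation hω (isCubicFactor_phiFactor hω) (by ring) evenPartialProdTendsto_phiNeg
    (fun n hn => ?_) fun n hn => coeff_phiNeg_sub_dilate hn
  rw [coeff_dilate, if_neg (by omega)]

theorem psi_cubic_relation :
    ((psi - PowerSeries.X * dilate 9 psi) ^ 3 + (PowerSeries.X * dilate 9 psi) ^ 3) * dilate 9 psi =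
      dilate 3 psi ^ 4 := by
  have hω := Complex.isPrimitiveRoot_exp 3 three_ne_zero
  refine cubic_relation hω (isCubicFactor_psiFactor hω) (by ring) evenPartialProdTendsto_psi
    (fun n hn => coeff_psi_sub_dilate hn) fun n hn => ?_
  rcases n with _ | n
  · simp
  · rw [PowerSeries.coeff_succ_X_mul, coeff_dilate, if_neg (by omega)]

/-! ### The operator U and its right inverse V -/

/-- The substitution `q ↦ q ^ 3` on formal Laurent series. -/
def V : ℚ⸨X⸩ →+* ℚ⸨X⸩ :=
  HahnSeries.embDomainRingHom (AddMonoidHom.mulLeft (3 : ℤ))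
    (fun a b h => by simpa using h) (fun a b => by simp)

theorem coeff_V_three_mul (f : ℚ⸨X⸩) (n : ℤ) : (V f).coeff (3 * n) = f.coeff n :=
  HahnSeries.embDomain_coeff (f := ⟨⟨AddMonoidHom.mulLeft (3 : ℤ), _⟩, _⟩)

theorem coeff_V_of_not_dvd (f : ℚ⸨X⸩) {n : ℤ} (hn : ¬ 3 ∣ n) : (V f).coeff n = 0 :=
  HahnSeries.embDomain_of_notMem_range fun ⟨m, hm⟩ => hn ⟨m, hm.symm⟩

theorem coeff_U (f : ℚ⸨X⸩) (n : ℤ) : (U f).coeff n = f.coeff (3 * n) := by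
  rw [U, HahnSeries.coeff_ofSuppBddBelow]

theorem coeff_q_zpow_mul (r n : ℤ) (f : ℚ⸨X⸩) : (q ^ r * f).coeff n = f.coeff (n - r) := by
  have : q ^ r = HahnSeries.single r (1 : ℚ) := by
    exact (RatFunc.single_zpow r).symm
  rw [this, HahnSeries.coeff_single_mul, one_mul]

theorem q_ne_zero : q ≠ 0 := by simp [q]

theorem U_add (f g : ℚ⸨X⸩) : U (f + g) = U f + U g := by
  ext n; simp [coeff_U]

theorem U_V (f : ℚ⸨X⸩) : U (V f) = f := by
  ext n; rw [coeff_U, coeff_V_three_mul]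

theorem U_q_zpow_mul_V {r : ℤ} (hr : ¬ 3 ∣ r) (f : ℚ⸨X⸩) : U (q ^ r * V f) = 0 := by
  ext n
  rw [coeff_U, coeff_q_zpow_mul, coeff_V_of_not_dvd _ (by omega), HahnSeries.coeff_zero]

theorem eq_q_zpow_mul_V {r : ℤ} {f : ℚ⸨X⸩} (hf : ∀ n, ¬ 3 ∣ n - r → f.coeff n = 0) :
    f = q ^ r * V (U (q ^ (-r) * f)) := by
  ext n
  rw [coeff_q_zpow_mul]
  by_cases h : 3 ∣ n - r
  · obtain ⟨m, hm⟩ := h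
    rw [hm, coeff_V_three_mul, coeff_U, coeff_q_zpow_mul, ← hm]
    congr 1; ring
  · rw [hf n h, coeff_V_of_not_dvd _ h]

theorem trisection (f : ℚ⸨X⸩) :
    f = V (U f) + q ^ (1 : ℤ) * V (U (q ^ (-1 : ℤ) * f)) +
      q ^ (2 : ℤ) * V (U (q ^ (-2 : ℤ) * f)) := by
  ext n
  simp only [HahnSeries.coeff_add, coeff_q_zpow_mul]
  obtain ⟨m, rfl | rfl | rfl⟩ : ∃ m, n = 3 * m ∨ n = 3 * m + 1 ∨ n = 3 * m + 2 :=
    ⟨n / 3, by omega⟩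
  · rw [coeff_V_three_mul, coeff_U, coeff_V_of_not_dvd _ (by omega),
      coeff_V_of_not_dvd _ (by omega)]
    ring
  · rw [coeff_V_of_not_dvd (U f) (by omega),
      coeff_V_of_not_dvd (U (q ^ (-2 : ℤ) * f)) (by omega),
      show 3 * m + 1 - 1 = 3 * m by ring, coeff_V_three_mul, coeff_U, coeff_q_zpow_mul]
    simp
  · rw [coeff_V_of_not_dvd (U f) (by omega),
      coeff_V_of_not_dvd (U (q ^ (-1 : ℤ) * f)) (by omega),
      show 3 * m + 2 - 2 = 3 * m by ring, coeff_V_three_mul, coeff_U, coeff_q_zpow_mul]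
    simp

/-- Multiplication by a series in q³ preserves each residue class of exponents, so U is linear over
the image of `V`. -/
theorem U_V_mul (a f : ℚ⸨X⸩) : U (V a * f) = a * U f := by
  have h1 := U_q_zpow_mul_V (r := 1) (by norm_num) (a * U (q ^ (-1 : ℤ) * f))
  have h2 := U_q_zpow_mul_V (r := 2) (by norm_num) (a * U (q ^ (-2 : ℤ) * f))
  have : V a * f = V (a * U f) + q ^ (1 : ℤ) * V (a * U (q ^ (-1 : ℤ) * f)) +
      q ^ (2 : ℤ) * V (a * U (q ^ (-2 : ℤ) * f)) := by
    conv_lhs => rw [trisection f]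
    simp only [map_mul]; ring
  rw [this, U_add, U_add, h1, h2, U_V, add_zero, add_zero]

theorem coeff_toLaurent (f : ℚ⟦X⟧) (n : ℤ) :
    (toLaurent f).coeff n = if n < 0 then 0 else PowerSeries.coeff n.natAbs f :=
  PowerSeries.coeff_coe f n

theorem V_toLaurent (f : ℚ⟦X⟧) : V (toLaurent f) = toLaurent (dilate 3 f) := by
  ext n
  rw [coeff_toLaurent (dilate 3 f), coeff_dilate]
  by_cases h : 3 ∣ n
  · obtain ⟨m, rfl⟩ := h
    rw [coeff_V_three_mul, coeff_toLaurent, if_pos (by omega : 3 ∣ (3 * m).natAbs),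
      show (3 * m).natAbs / 3 = m.natAbs by omega]
    simp only [show 3 * m < 0 ↔ m < 0 by omega]
  · rw [coeff_V_of_not_dvd _ h, if_neg (by omega : ¬ 3 ∣ n.natAbs), ite_self]

theorem V_q : V q = q ^ 3 := by
  ext n
  by_cases h : 3 ∣ n
  · obtain ⟨m, rfl⟩ := h
    rw [coeff_V_three_mul, ← mul_one (q ^ 3), ← zpow_natCast, coeff_q_zpow_mul, q,
      HahnSeries.coeff_single, HahnSeries.coeff_one]
    congr 1
    simp only [eq_iff_iff]; push_cast; omega
  · rw [coeff_V_of_not_dvd _ h, ← mul_one (q ^ 3), ← zpow_natCast, coeff_q_zpow_mul,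
      HahnSeries.coeff_one, if_neg (by push_cast; omega)]

theorem toLaurent_mul (f g : ℚ⟦X⟧) : toLaurent (f * g) = toLaurent f * toLaurent g :=
  map_mul (HahnSeries.ofPowerSeries ℤ ℚ) f g

theorem toLaurent_add (f g : ℚ⟦X⟧) : toLaurent (f + g) = toLaurent f + toLaurent g :=
  map_add (HahnSeries.ofPowerSeries ℤ ℚ) f g

theorem toLaurent_sub (f g : ℚ⟦X⟧) : toLaurent (f - g) = toLaurent f - toLaurent g :=
  map_sub (HahnSeries.ofPowerSeries ℤ ℚ) f g

theorem toLaurent_pow (f : ℚ⟦X⟧) (n : ℕ) : toLaurent (f ^ n) = toLaurent f ^ n :=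
  map_pow (HahnSeries.ofPowerSeries ℤ ℚ) f n

theorem toLaurent_X : toLaurent PowerSeries.X = q := HahnSeries.ofPowerSeries_X

theorem toLaurent_ne_zero {f : ℚ⟦X⟧} (hf : f ≠ 0) : toLaurent f ≠ 0 := fun h =>
  hf (HahnSeries.ofPowerSeries_injective (Γ := ℤ) (by
    rw [map_zero]; exact h))

theorem toLaurent_inv {f : ℚ⟦X⟧} (hf : PowerSeries.constantCoeff f = 1) :
    toLaurent f⁻¹ = (toLaurent f)⁻¹ := by
  refine eq_inv_of_mul_eq_one_right ?_
  rw [← toLaurent_mul, PowerSeries.mul_inv_cancel _ (by simp [hf])]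
  exact map_one (HahnSeries.ofPowerSeries ℤ ℚ)

/-! ### The recurrence for U on powers -/

/-- The polynomials `X_i` with `U (y ^ i) = X_i(y)`. -/
def degreeThreePoly : ℕ → ℤ[X]
  | 0 => 1
  | 1 => Polynomial.X - 3 * Polynomial.X ^ 2 + 3 * Polynomial.X ^ 3
  | 2 => 3 * (Polynomial.X - 3 * Polynomial.X ^ 2 + 3 * Polynomial.X ^ 3) ^ 2 -
      2 * (Polynomial.X - 3 * Polynomial.X ^ 2 + 3 * Polynomial.X ^ 3)
  | i + 3 => (Polynomial.X - 3 * Polynomial.X ^ 2 + 3 * Polynomial.X ^ 3) *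
      (degreeThreePoly i - 3 * degreeThreePoly (i + 1) + 3 * degreeThreePoly (i + 2))

/-- If `1 / y - 1` lies in the eigenspace of exponents `r` modulo three, and its cube is
`1 / m(q ^ 3) - 1` for `m = y - 3 y ^ 2 + 3 y ^ 3`, then `U` acts on the powers of `y` through
`degreeThreePoly`. -/
theorem U_pow_eq_aeval {y c : ℚ⸨X⸩} {r : ℤ} (hr : ¬ 3 ∣ r) (hy : y ≠ 0)
    (hyc : y⁻¹ = 1 + q ^ r * V c)
    (hm : V (y - 3 * y ^ 2 + 3 * y ^ 3) * (1 + (q ^ r * V c) ^ 3) = 1) (i : ℕ) :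
    U (y ^ i) = Polynomial.aeval y (degreeThreePoly i) := by
  have hu : U (q ^ r * V c) = 0 := U_q_zpow_mul_V hr c
  have hu2 : U ((q ^ r * V c) ^ 2) = 0 := by
    have : (q ^ r * V c) ^ 2 = q ^ (r * 2) * V (c ^ 2) := by
      rw [mul_pow, map_pow, zpow_mul, zpow_ofNat]
    rw [this, U_q_zpow_mul_V (by omega)]
  generalize hu' : q ^ r * V c = u at *
  have hyu : y * (1 + u) = 1 := by rw [← hyc, mul_inv_cancel₀ hy]
  induction i using degreeThreePoly.induct with
  | case1 =>
    rw [degreeThreePoly, pow_zero, map_one]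
    simpa using U_V 1
  | case2 =>
    simp only [degreeThreePoly, map_add, map_sub, map_mul, map_pow, Polynomial.aeval_X, map_ofNat]
    generalize y - 3 * y ^ 2 + 3 * y ^ 3 = m at *
    -- Since 1/y = 1 + u, this is (1 + u)(1 - u + u²) = 1 + u³ = 1/V(m). U kills the u and u² terms.
    have e : y ^ 1 = V m + (V (-m) * u + V m * u ^ 2) := by
      rw [map_neg]
      linear_combination V m * (1 - u + u ^ 2) * hyu - y * hm
    rw [e, U_add, U_add, U_V_mul, U_V_mul, hu, hu2, U_V]
    ring
  | case3 =>
    simp only [degreeThreePoly, map_add, map_sub, map_mul, map_pow, Polynomial.aeval_X, map_ofNat]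
    generalize y - 3 * y ^ 2 + 3 * y ^ 3 = m at *
    have e1 : y = V m * (1 - u + u ^ 2) := by
      linear_combination V m * (1 - u + u ^ 2) * hyu - y * hm
    -- Square the previous expression and lower the degree in u by V(m)u³ = 1 - V(m).
    have e : y ^ 2 = V (3 * m ^ 2 - 2 * m) + (V (m - 3 * m ^ 2) * u + V (3 * m ^ 2) * u ^ 2) := by
      rw [e1]
      simp only [map_sub, map_mul, map_pow, map_ofNat]
      linear_combination V m * (u - 2) * hm
    rw [e, U_add, U_add, U_V_mul, U_V_mul, hu, hu2, U_V]
    ring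
  | case4 i ih0 ih1 ih2 =>
    simp only [degreeThreePoly, map_add, map_sub, map_mul, map_pow, Polynomial.aeval_X, map_ofNat,
      ← ih0, ← ih1, ← ih2]
    generalize y - 3 * y ^ 2 + 3 * y ^ 3 = m at *
    -- Clearing y from V(m)(1 + u³) = 1 with u = 1/y - 1 gives a cubic equation for y over series in
    -- q³.
    have e : y ^ (i + 3) = V m * y ^ i + (V (-3 * m) * y ^ (i + 1) + V (3 * m) * y ^ (i + 2)) := by
      simp only [map_neg, map_mul, map_ofNat]
      have h1 : u = y⁻¹ - 1 := by rw [hyc]; ring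
      have h2 : V m * (y ^ 3 + (1 - y) ^ 3) = y ^ 3 := by
        rw [h1] at hm
        field_simp at hm
        linear_combination hm
      linear_combination -y ^ i * h2
    rw [e, U_add, U_add, U_V_mul, U_V_mul, U_V_mul]
    ring

/-- The abstract form of the modular equation: if `f = g + h`, `g (g ^ 3 + h ^ 3) = p` and
`V (p / f ^ 4) = g ^ 4 / p`, then `y = g / f` satisfies the hypotheses of `U_pow_eq_aeval`. -/
theorem U_div_pow_eq_aeval {f g p c : ℚ⸨X⸩} {r : ℤ} (hr : ¬ 3 ∣ r) (hf : f ≠ 0) (hg : g ≠ 0)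
    (hp : p ≠ 0) (hc : f - g = g * (q ^ r * V c)) (hgp : g * (g ^ 3 + (f - g) ^ 3) = p)
    (hV : V (p / f ^ 4) = g ^ 4 / p) (i : ℕ) :
    U ((g / f) ^ i) = Polynomial.aeval (g / f) (degreeThreePoly i) := by
  have hu : q ^ r * V c = (f - g) / g := by rw [hc, mul_div_cancel_left₀ _ hg]
  refine U_pow_eq_aeval (c := c) hr (div_ne_zero hg hf) ?_ ?_ i
  · rw [hu]; field_simp; ring
  -- The left side is y(y³ + (1 - y)³) for y = g/f.
  · have e : g / f - 3 * (g / f) ^ 2 + 3 * (g / f) ^ 3 = p / f ^ 4 := by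
      rw [← hgp]; field_simp; ring
    rw [e, hV, hu]
    field_simp
    linear_combination hgp

/-! ### Application to ξ, ζ and δ -/

theorem phiNeg_ne_zero : phiNeg ≠ 0 := fun h => by simpa [h] using constantCoeff_phiNeg

theorem psi_ne_zero : psi ≠ 0 := fun h => by simpa [h] using constantCoeff_psi

theorem dilate_ne_zero (m : ℕ) [NeZero m] {f : ℚ⟦X⟧} (hf : PowerSeries.constantCoeff f = 1) :
    dilate m f ≠ 0 := fun h => by
  have : PowerSeries.constantCoeff (dilate m f) = 1 := by
    rw [dilate, PowerSeries.constantCoeff_expand, hf]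
  simp [h] at this

theorem V_toLaurent_dilate_three (f : ℚ⟦X⟧) :
    V (toLaurent (dilate 3 f)) = toLaurent (dilate 9 f) := by
  rw [V_toLaurent, dilate_three_dilate_three]

theorem U_xi_pow (i : ℕ) : U (xi ^ i) = Polynomial.aeval xi (degreeThreePoly i) := by
  have h9 := toLaurent_ne_zero (dilate_ne_zero 9 constantCoeff_phiNeg)
  have h3 := toLaurent_ne_zero (dilate_ne_zero 3 constantCoeff_phiNeg)
  have h1 := toLaurent_ne_zero phiNeg_ne_zero
  have hs := eq_q_zpow_mul_V (r := 1) (f := toLaurent (phiNeg - dilate 9 phiNeg)) fun n hn => by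
    rw [coeff_toLaurent]
    split_ifs with h
    · rfl
    · exact coeff_phiNeg_sub_dilate (by omega)
  refine U_div_pow_eq_aeval (r := 1) (p := toLaurent (dilate 3 phiNeg) ^ 4)
    (c := U (q ^ (-1 : ℤ) * toLaurent (phiNeg - dilate 9 phiNeg)) / toLaurent (dilate 3 phiNeg))
    (by norm_num) h1 h9 (pow_ne_zero _ h3) ?_ ?_ ?_ i
  · rw [map_div₀, V_toLaurent_dilate_three, ← mul_div_assoc, ← hs, mul_div_cancel₀ _ h9,
      toLaurent_sub]
  · have := congrArg toLaurent phiNeg_cubic_relation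
    simp only [toLaurent_mul, toLaurent_add, toLaurent_pow, toLaurent_sub] at this
    rw [← this]; ring
  · rw [map_div₀, map_pow, map_pow, V_toLaurent_dilate_three, V_toLaurent]

theorem zeta_eq : zeta = (q * toLaurent (dilate 9 psi)) / toLaurent psi := by
  rw [zeta, mul_div_assoc]

theorem U_zeta_pow (i : ℕ) : U (zeta ^ i) = Polynomial.aeval zeta (degreeThreePoly i) := by
  have h9 := toLaurent_ne_zero (dilate_ne_zero 9 constantCoeff_psi)
  have h3 := toLaurent_ne_zero (dilate_ne_zero 3 constantCoeff_psi)
  have h1 := toLaurent_ne_zero psi_ne_zero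
  have hs := eq_q_zpow_mul_V (r := 0) (f := toLaurent (psi - PowerSeries.X * dilate 9 psi))
    fun n hn => by
      rw [coeff_toLaurent]
      split_ifs with h
      · rfl
      · exact coeff_psi_sub_dilate (by omega)
  rw [zeta_eq]
  -- The exponents of f - g are 0 modulo 3 and those of g = qψ(q⁹) are 1, whence r = -1. The factor
  -- q of g also enters p.
  refine U_div_pow_eq_aeval (r := -1) (p := q * toLaurent (dilate 3 psi) ^ 4)
    (c := U (q ^ (-0 : ℤ) * toLaurent (psi - PowerSeries.X * dilate 9 psi)) /
      toLaurent (dilate 3 psi))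
    (by norm_num) h1 (mul_ne_zero q_ne_zero h9) (mul_ne_zero q_ne_zero (pow_ne_zero _ h3))
    ?_ ?_ ?_ i
  · rw [zpow_zero, one_mul] at hs
    rw [map_div₀, ← hs, V_toLaurent_dilate_three, toLaurent_sub, toLaurent_mul, toLaurent_X,
      zpow_neg_one]
    have := q_ne_zero
    field_simp
  · have := congrArg toLaurent psi_cubic_relation
    simp only [toLaurent_mul, toLaurent_add, toLaurent_pow, toLaurent_sub, toLaurent_X] at this
    rw [← this]; ring
  · have := q_ne_zero
    rw [map_div₀, map_mul, map_pow, map_pow, V_toLaurent_dilate_three, V_toLaurent, V_q]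
    field_simp

theorem toLaurent_dilate_G (m : ℕ) [NeZero m] :
    toLaurent (dilate m G) =
      toLaurent (dilate m (dilate 3 psi)) / toLaurent (dilate m psi) := by
  rw [eq_div_iff (toLaurent_ne_zero (dilate_ne_zero m constantCoeff_psi)), ← toLaurent_mul]
  congr 1
  rw [dilate, dilate, dilate, ← map_mul]
  congr 1
  rw [G, mul_assoc, PowerSeries.inv_mul_cancel _ (by simp [constantCoeff_psi]), mul_one]

/-- G(q)/G(q⁹) = ψ(q³)ψ(q⁹)/(ψ(q)ψ(q²⁷)), so δ = ζ(q)/ζ(q³), and the denominator passes through U.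
-/
theorem delta_eq : delta = V zeta⁻¹ * zeta := by
  have h9 := toLaurent_ne_zero (dilate_ne_zero 9 constantCoeff_psi)
  have h3 := toLaurent_ne_zero (dilate_ne_zero 3 constantCoeff_psi)
  have h1 := toLaurent_ne_zero psi_ne_zero
  have h27 : dilate 9 (dilate 3 psi) = dilate 3 (dilate 9 psi) := by
    ext n
    simp only [coeff_dilate]
    split_ifs <;> first | omega | simp [Nat.div_div_eq_div_mul]
  have hG : toLaurent G = toLaurent (dilate 3 psi) / toLaurent psi := by
    rw [G, toLaurent_mul, toLaurent_inv constantCoeff_psi, div_eq_mul_inv]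
  have hq := q_ne_zero
  rw [delta, toLaurent_dilate_G, hG, h27, zeta, map_inv₀, map_mul, map_div₀, V_q, V_toLaurent,
    V_toLaurent, zpow_neg, zpow_ofNat]
  have h0 : toLaurent (dilate 3 (dilate 9 psi)) ≠ 0 := by
    rw [← V_toLaurent]
    exact (map_ne_zero V).2 h9
  field_simp

/-! ### Transcendence of ξ -/

/-- The constant term of P(x) is P(0), so P(0) = 0; cancelling x lowers the degree. -/
theorem eq_zero_of_aeval_eq_zero {x : ℚ⟦X⟧} (hx : PowerSeries.constantCoeff x = 0) (hx0 : x ≠ 0)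
    {P : ℚ[X]} (hP : Polynomial.aeval x P = 0) : P = 0 := by
  induction h : P.natDegree using Nat.strong_induction_on generalizing P with
  | _ n ih =>
    have hc : P.coeff 0 = 0 := by
      have h1 := congrArg PowerSeries.constantCoeff hP
      rw [← Polynomial.divX_mul_X_add P] at h1
      simpa [hx] using h1
    have hd := Polynomial.divX_mul_X_add P
    rw [hc, map_zero, add_zero] at hd
    rw [← hd, map_mul, Polynomial.aeval_X, mul_eq_zero, or_iff_left hx0] at hP
    by_cases hn : n = 0
    · rw [Polynomial.eq_C_of_natDegree_eq_zero (h.trans hn), hc, map_zero]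
    · rw [← hd, ih _ (by rw [Polynomial.natDegree_divX_eq_natDegree_tsub_one]; omega) hP rfl,
        zero_mul]

/-- A nonconstant power series is transcendental over the constants. -/
theorem transcendental_of_constantCoeff_ne {x : ℚ⟦X⟧} {c : ℚ}
    (hx : x ≠ PowerSeries.C c) (hc : PowerSeries.constantCoeff x = c) : Transcendental ℚ x := by
  rw [transcendental_iff]
  intro P hP
  have h1 : Polynomial.aeval (x - PowerSeries.C c) (P.comp (Polynomial.X + Polynomial.C c)) = 0 := by
    rw [Polynomial.aeval_comp]
    simpa [← PowerSeries.algebraMap_eq] using hP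
  have h2 := eq_zero_of_aeval_eq_zero (by simp [hc]) (sub_ne_zero.2 hx) h1
  refine (Polynomial.comp_eq_zero_iff.1 h2).resolve_right fun h => ?_
  have h3 := congrArg Polynomial.natDegree h.2
  rw [Polynomial.natDegree_X_add_C, Polynomial.natDegree_C] at h3
  exact one_ne_zero h3

theorem transcendental_xi : Transcendental ℤ xi := by
  have hc : PowerSeries.constantCoeff (dilate 9 phiNeg * phiNeg⁻¹) = 1 := by
    rw [map_mul, dilate, PowerSeries.constantCoeff_expand, PowerSeries.constantCoeff_inv,
      constantCoeff_phiNeg, inv_one, mul_one]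
  -- The coefficient of q is -2 in φ(-q) but 0 in φ(-q⁹).
  have hne : dilate 9 phiNeg * phiNeg⁻¹ ≠ PowerSeries.C 1 := by
    intro h
    have h1 : dilate 9 phiNeg = phiNeg := by
      have h2 := PowerSeries.inv_mul_cancel phiNeg (by simp [constantCoeff_phiNeg])
      rw [map_one] at h
      linear_combination phiNeg * h - dilate 9 phiNeg * h2
    have h3 := congrArg (PowerSeries.coeff 1) h1
    rw [coeff_dilate, if_neg (by norm_num), coeff_one_phiNeg] at h3
    norm_num at h3
  have ht := (transcendental_of_constantCoeff_ne hne hc).restrictScalars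
    (R := ℤ) (algebraMap ℤ ℚ).injective_int
  have hxi : xi = HahnSeries.ofPowerSeries ℤ ℚ (dilate 9 phiNeg * phiNeg⁻¹) := by
    rw [xi, div_eq_mul_inv, ← toLaurent_inv constantCoeff_phiNeg, ← toLaurent_mul]
    rfl
  rw [transcendental_iff] at ht ⊢
  refine fun P hP => ht P (HahnSeries.ofPowerSeries_injective (Γ := ℤ) ?_)
  rw [Polynomial.aeval_def, Polynomial.hom_eval₂, map_zero, ← hxi, ← hP, Polynomial.aeval_def,
    RingHom.ext_int (RingHom.comp _ _) (algebraMap ℤ ℚ⸨X⸩)]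

end

end ThetaSeries

theorem theorem5p1 (i : ℕ) :
    (∃ P : ℤ[X],
      ThetaSeries.U (ThetaSeries.xi ^ i) = Polynomial.aeval ThetaSeries.xi P ∧
      (∀ Q : ℤ[X],
        ThetaSeries.U (ThetaSeries.xi ^ i) = Polynomial.aeval ThetaSeries.xi Q → Q = P) ∧
      ThetaSeries.U (ThetaSeries.zeta ^ i) = Polynomial.aeval ThetaSeries.zeta P) ∧
    ThetaSeries.U (ThetaSeries.delta * ThetaSeries.zeta ^ i) =
      ThetaSeries.zeta⁻¹ * ThetaSeries.U (ThetaSeries.zeta ^ (i + 1)) := by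
  refine ⟨⟨ThetaSeries.degreeThreePoly i, ThetaSeries.U_xi_pow i, fun Q hQ => ?_,
    ThetaSeries.U_zeta_pow i⟩, ?_⟩
  · exact transcendental_iff_injective.1 ThetaSeries.transcendental_xi
      (hQ.symm.trans (ThetaSeries.U_xi_pow i))
  · rw [ThetaSeries.delta_eq, mul_assoc, ← pow_succ', ThetaSeries.U_V_mul]
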